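/- Let $G$ be any simple graph, finite or infinite. A \emph{vertex end} of $G$ is an equivalence class of rays (one-way infinite paths), where two rays are equivalent if they cannot be separated in $G$ by removing finitely many vertices, i.e. if for every finite vertex set $S$ both have a tail in the same component of $G-S$. A \emph{separation} is a set $X\subseteq E(G)$, with complement $X^\complement=E(G)\setminus X$; $V(X)$ is the set of vertices incident with an edge from $X$, and the \emph{order} of $X$ is the number of vertices incident with both an edge from $X$ and an edge from $X^\complement$. Separations $X,Y$ are \emph{nested} if $X\subseteq Y$, $X^\complement\subseteq Y$, $Y\subseteq X$ or $Y\subseteq X^\complement$. A vertex end $\omega$ \emph{lives} in a separation $X$ of finite order if $V(X)$ contains a ray belonging to $\omega$. A separation $X$ of finite order \emph{distinguishes} two vertex ends if one of them lives in $X$ and the other in $X^\complement$; it distinguishes them \emph{efficiently} if it has minimal order amongst all separations distinguishing them. Then there is a set $\mathcal N$ of separations of $G$ of finite order, any two of which are nested, such that for any two distinct vertex ends $\omega,\mu$ of $G$ some $X\in\mathcal N$ distinguishes $\omega$ and $\mu$ efficiently. -/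

import Mathlib

open Filter

namespace SimpleGraph

variable {V : Type*}

/-- A ray (one-way infinite path) of `G`, given by its vertices in order from its first vertex. -/
structure Ray (G : SimpleGraph V) where
  /-- The vertices of the ray, in order. -/
  toFun : ℕ → V
  injective : Function.Injective toFun
  adj : ∀ n, G.Adj (toFun n) (toFun (n + 1))

/-- The ray `R` has a tail in the component `C` of `G - S`. -/
def Ray.HasTailIn {G : SimpleGraph V} (R : G.Ray) {S : Set V} (C : G.ComponentCompl S) : Prop :=
  ∀ᶠ n in atTop, R.toFun n ∈ C

/-- Two rays are equivalent if no finite vertex set `S` separates them, that is, if for every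
finite `S` they both have a tail in the same component of `G - S`. -/
def Ray.Equivalent {G : SimpleGraph V} (R R' : G.Ray) : Prop :=
  ∀ S : Set V, S.Finite → ∃ C : G.ComponentCompl S, R.HasTailIn C ∧ R'.HasTailIn C

theorem Ray.exists_hasTailIn {G : SimpleGraph V} (R : G.Ray) {S : Set V} (hS : S.Finite) :
    ∃ C : G.ComponentCompl S, R.HasTailIn C := by
  have hfin : (R.toFun ⁻¹' S).Finite := hS.preimage R.injective.injOn
  obtain ⟨N, hN⟩ := hfin.bddAbove
  have hout : ∀ n, N + 1 ≤ n → R.toFun n ∉ S := fun n hn hmem => by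
    have : n ≤ N := hN hmem
    omega
  refine ⟨G.componentComplMk (hout (N + 1) le_rfl), eventually_atTop.2 ⟨N + 1, fun n hn => ?_⟩⟩
  induction n, hn using Nat.le_induction with
  | base => exact componentComplMk_mem G _
  | succ n hn ih =>
    obtain ⟨h, hC⟩ := ih
    refine ⟨hout (n + 1) (by omega), ?_⟩
    rw [← hC]
    exact (componentComplMk_eq_of_adj G _ _ (R.adj n)).symm

theorem Ray.equivalent_equivalence (G : SimpleGraph V) :
    Equivalence (Ray.Equivalent : G.Ray → G.Ray → Prop) where
  refl R S hS := by
    obtain ⟨C, hC⟩ := R.exists_hasTailIn hS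
    exact ⟨C, hC, hC⟩
  symm h S hS := by
    obtain ⟨C, h1, h2⟩ := h S hS
    exact ⟨C, h2, h1⟩
  trans h h' S hS := by
    obtain ⟨C, h1, h2⟩ := h S hS
    obtain ⟨D, h3, h4⟩ := h' S hS
    obtain ⟨n, ⟨_, hC⟩, ⟨_, hD⟩⟩ := (Eventually.and h2 h3).exists
    have hCD : C = D := hC.symm.trans hD
    subst hCD
    exact ⟨C, h1, h4⟩

/-- Equivalence of rays as a setoid. -/
def raySetoid (G : SimpleGraph V) : Setoid G.Ray :=
  ⟨Ray.Equivalent, Ray.equivalent_equivalence G⟩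

/-- A vertex end of `G` is an equivalence class of rays. -/
def VertexEnd (G : SimpleGraph V) : Type _ :=
  Quotient G.raySetoid

/-- The ray `R` belongs to the vertex end `ω`. -/
def Ray.BelongsTo {G : SimpleGraph V} (R : G.Ray) (ω : G.VertexEnd) : Prop :=
  Quotient.mk G.raySetoid R = ω

/-- A separation of `G` is a set of edges of `G`; its complement `Xᶜ` is taken in the edge set. -/
abbrev EdgeSeparation (G : SimpleGraph V) : Type _ :=
  Set G.edgeSet

namespace EdgeSeparation

variable {G : SimpleGraph V}

/-- `V(X)`: the vertices incident with an edge from `X`. -/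
def verts (X : G.EdgeSeparation) : Set V :=
  {v | ∃ e ∈ X, v ∈ (e : Sym2 V)}

/-- `∂(X)`: the vertices incident with an edge from `X` and with an edge from `Xᶜ`. -/
def boundary (X : G.EdgeSeparation) : Set V :=
  {v | (∃ e ∈ X, v ∈ (e : Sym2 V)) ∧ ∃ f ∈ Xᶜ, v ∈ (f : Sym2 V)}

/-- The order of `X` is the number of vertices in its boundary. -/
noncomputable def order (X : G.EdgeSeparation) : ℕ∞ :=
  (boundary X).encard

/-- `X` has finite order. -/
def FiniteOrder (X : G.EdgeSeparation) : Prop :=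
  order X < ⊤

/-- `X` and `Y` are nested. -/
def Nested (X Y : G.EdgeSeparation) : Prop :=
  X ⊆ Y ∨ Xᶜ ⊆ Y ∨ Y ⊆ X ∨ Y ⊆ Xᶜ

/-- The vertex end `ω` lives in `X`, used for `X` of finite order:
`V(X)` contains a ray belonging to `ω`. -/
def Lives (ω : G.VertexEnd) (X : G.EdgeSeparation) : Prop :=
  ∃ R : G.Ray, R.BelongsTo ω ∧ ∀ n, R.toFun n ∈ verts X

/-- `X` has finite order, and one of the vertex ends `ω`, `μ` lives in `X` and the other
in `Xᶜ`. -/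
def Distinguishes (X : G.EdgeSeparation) (ω μ : G.VertexEnd) : Prop :=
  FiniteOrder X ∧ ((Lives ω X ∧ Lives μ Xᶜ) ∨ (Lives μ X ∧ Lives ω Xᶜ))

/-- `X` has minimal order among all separations distinguishing `ω` and `μ`. -/
def DistinguishesEfficiently (X : G.EdgeSeparation) (ω μ : G.VertexEnd) : Prop :=
  Distinguishes X ω μ ∧ ∀ Y : G.EdgeSeparation, Distinguishes Y ω μ → order X ≤ order Y

end EdgeSeparation

end SimpleGraph

/-! Inequivalent rays are separated by a finite vertex set, and a smallest such set is tight at the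
components of both rays. Between tight separators `Unsplit` is symmetric and plays the role of
nestedness. A finite set crosses only finitely many tight separators of given size
(`finite_crossing`), so crossings can be counted and minimised.

A nested family of smallest separators is built by recursion on their size `k`. Smallest separators
nested with all smaller members exist (`exists_isNestedMinSeparator`); among these, the ones
crossing fewest tight separators of size `k` are added. Two added ones cannot cross: by
submodularity opposite corners would again be smallest separators, with strictly fewer crossings in
total (`OppositeCorners.ncard_crossing_lt`, `IsOptimalSeparator.unsplit`).

A tight component of `G - X` yields the separation formed by the edges meeting it. Two of these are
nested unless each component meets the other's separator. A well-order discards at most one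
component per separator, hitting every such bad pair (`isSelected_or_isSelected`). For two ends
separated by `X`, one of their two components survives, and either suffices. -/

namespace SimpleGraph

variable {V : Type*} {G : SimpleGraph V}

/-! ### Components and tightness -/

namespace ComponentCompl

variable {S T : Set V}

theorem eq_of_mem {C D : G.ComponentCompl S} {v : V} (hC : v ∈ C) (hD : v ∈ D) : C = D :=
  hC.choose_spec.symm.trans hD.choose_spec

/-- A property of one vertex of a component that spreads along the edges of the component holds
throughout the component. -/
theorem forall_mem_of_adj {C : G.ComponentCompl S} {P : V → Prop} {u : V} (hu : u ∈ C)
    (hP : P u) (h : ∀ v w, v ∈ C → w ∈ C → G.Adj v w → P v → P w) : ∀ v ∈ C, P v := by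
  rintro v hv
  obtain ⟨hvS, hv'⟩ := hv
  obtain ⟨huS, hu'⟩ := hu
  have hr : (G.induce Sᶜ).Reachable ⟨u, huS⟩ ⟨v, hvS⟩ :=
    ConnectedComponent.eq.1 (hu'.trans hv'.symm)
  obtain ⟨p⟩ := hr
  have key : ∀ (a b : (Sᶜ : Set V)), (G.induce Sᶜ).Walk a b → (a : V) ∈ C → P a → P b := by
    intro a b p
    induction p with
    | nil => exact fun _ h => h
    | @cons a b c hab p ih =>
      intro ha hPa
      have hb : (b : V) ∈ C := mem_of_adj _ _ ha b.2 hab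
      exact ih hb (h _ _ ha hb hab hPa)
  exact key _ _ p ⟨huS, hu'⟩ hP

/-- A component of `G - S` that avoids `T` lies in a component of `G - T`, which also contains
its neighbours outside `T`. -/
theorem exists_superset (C : G.ComponentCompl S) (hC : ∀ v ∈ C, v ∉ T) :
    ∃ D : G.ComponentCompl T, (∀ v ∈ C, v ∈ D) ∧
      ∀ v ∈ C, ∀ w, w ∉ T → G.Adj v w → w ∈ D := by
  obtain ⟨u, hu⟩ := C.nonempty
  have hCD : ∀ v ∈ C, v ∈ G.componentComplMk (hC u hu) :=
    forall_mem_of_adj hu (componentComplMk_mem G _)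
      fun v w _ hw hvw hv => mem_of_adj _ _ hv (hC w hw) hvw
  exact ⟨_, hCD, fun v hv w hw hvw => mem_of_adj _ _ (hCD v hv) hw hvw⟩

/-- A component of `G - S` is tight if each vertex of `S` has a neighbour in it. -/
def IsTight (C : G.ComponentCompl S) : Prop :=
  ∀ s ∈ S, ∃ c ∈ C, G.Adj c s

theorem IsTight.exists_superset {C : G.ComponentCompl S} (h : C.IsTight) (hC : ∀ v ∈ C, v ∉ T) :
    ∃ D : G.ComponentCompl T, (∀ v ∈ C, v ∈ D) ∧ ∀ s ∈ S, s ∉ T → s ∈ D := by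
  obtain ⟨D, h1, h2⟩ := C.exists_superset hC
  refine ⟨D, h1, fun s hs hsT => ?_⟩
  obtain ⟨c, hc, hcs⟩ := h s hs
  exact h2 c hc s hsT hcs

end ComponentCompl

/-! ### Nestedness of vertex separators -/

open ComponentCompl

/-- `S` has at least two tight components. -/
def IsTightSeparator (G : SimpleGraph V) (S : Set V) : Prop :=
  ∃ C D : G.ComponentCompl S, C ≠ D ∧ C.IsTight ∧ D.IsTight

/-- `S` meets at most one component of `G - T`. -/
def Unsplit (G : SimpleGraph V) (S T : Set V) : Prop :=
  ∀ ⦃x⦄, x ∈ S → ∀ ⦃y⦄, y ∈ S → ∀ ⦃C D : G.ComponentCompl T⦄, x ∈ C → y ∈ D → C = D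

theorem Unsplit.avoids {S T : Set V} (h : G.Unsplit S T) {C D : G.ComponentCompl T}
    (hCD : C ≠ D) : (∀ v ∈ C, v ∉ S) ∨ ∀ v ∈ D, v ∉ S := by
  by_contra! hne
  obtain ⟨⟨x, hxC, hx⟩, y, hyD, hy⟩ := hne
  exact hCD (h hx hy hxC hyD)

/-- The component of `G - S` around `C` absorbs every vertex of `T` outside `S`, since each has a
neighbour in `C`. -/
theorem ComponentCompl.IsTight.unsplit {S T : Set V} {C : G.ComponentCompl T} (h : C.IsTight)
    (hC : ∀ v ∈ C, v ∉ S) : G.Unsplit T S := by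
  obtain ⟨D, -, hD⟩ := h.exists_superset hC
  intro x hx y hy E F hE hF
  exact (eq_of_mem hE (hD x hx (notMem_of_mem hE))).trans
    (eq_of_mem (hD y hy (notMem_of_mem hF)) hF)

/-- One of two tight components of `G - T` must avoid `S`. -/
theorem Unsplit.symm {S T : Set V} (h : G.Unsplit S T) (hT : G.IsTightSeparator T) :
    G.Unsplit T S := by
  obtain ⟨C, D, hCD, hC, hD⟩ := hT
  rcases h.avoids hCD with h' | h'
  · exact hC.unsplit h'
  · exact hD.unsplit h'

/-- A set that splits neither of two crossing separators does not split their union. -/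
theorem Unsplit.of_subset_union {X Y Z U : Set V} (hY : G.IsTightSeparator Y)
    (hYX : ¬ G.Unsplit Y X) (hZ : Z ⊆ X ∪ Y)
    (hXU : G.Unsplit X U) (hUY : G.Unsplit U Y) : G.Unsplit Z U := by
  obtain ⟨K, hK, hKU⟩ : ∃ K : G.ComponentCompl Y, K.IsTight ∧ ∀ v ∈ K, v ∉ U := by
    obtain ⟨C, D, hCD, hC, hD⟩ := hY
    rcases hUY.avoids hCD with h' | h'
    exacts [⟨C, hC, h'⟩, ⟨D, hD, h'⟩]
  -- This `x` anchors `X` in the component of `G - U` around `K`, which also contains `Y` outside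
  -- `U`.
  obtain ⟨x, hxK, hxX⟩ : ∃ x ∈ K, x ∈ X := by
    by_contra! h
    exact hYX (hK.unsplit h)
  obtain ⟨E, hKE, hYE⟩ := hK.exists_superset hKU
  have key : ∀ z ∈ Z, ∀ F : G.ComponentCompl U, z ∈ F → F = E := by
    intro z hz F hF
    rcases hZ hz with h | h
    · exact hXU h hxX hF (hKE x hxK)
    · exact eq_of_mem hF (hYE z h (notMem_of_mem hF))
  intro x hx y hy C D hC hD
  rw [key x hx C hC, key y hy D hD]

/-! ### Finiteness of crossings -/

/-- Two vertices of a component of `G - W` are linked by finitely many vertices outside `W`, one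
of which lies in each set separating them. -/
theorem ComponentCompl.exists_finset_link {W : Set V} {E : G.ComponentCompl W} {u v : V}
    (hu : u ∈ E) (hv : v ∈ E) :
    ∃ P : Finset V, (∀ p ∈ P, p ∉ W) ∧ ∀ (Y : Set V) (C D : G.ComponentCompl Y),
      C ≠ D → u ∈ C → v ∈ D → ∃ p ∈ P, p ∈ Y := by
  classical
  suffices h : ∃ P : Finset V, (∀ p ∈ P, p ∉ W) ∧ ∀ (Y : Set V) (C : G.ComponentCompl Y),
      u ∈ C → (∀ p ∈ P, p ∉ Y) → v ∈ C by
    obtain ⟨P, hP, h⟩ := h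
    refine ⟨P, hP, fun Y C D hCD hC hD => ?_⟩
    by_contra! hne
    exact hCD (eq_of_mem (h Y C hC hne) hD)
  refine forall_mem_of_adj (C := E) (P := fun v => ∃ P : Finset V, (∀ p ∈ P, p ∉ W) ∧
    ∀ (Y : Set V) (C : G.ComponentCompl Y), u ∈ C → (∀ p ∈ P, p ∉ Y) → v ∈ C) hu ⟨∅, by simp, fun _ _ h _ => h⟩ ?_ v hv
  rintro v w - hw hvw ⟨P, hP, h⟩
  refine ⟨insert w P, ?_, fun Y C hC hY => ?_⟩
  · simp only [Finset.mem_insert, forall_eq_or_imp]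
    exact ⟨notMem_of_mem hw, hP⟩
  · simp only [Finset.mem_insert, forall_eq_or_imp] at hY
    exact mem_of_adj _ _ (h Y C hC hY.2) hY.1 hvw

/-- Only finitely many sets of given size are minimal separators of two given vertices. -/
theorem finite_tight_separators (G : SimpleGraph V) (u v : V) (n : ℕ) (W : Finset V) :
    {Y : Finset V | W ⊆ Y ∧ Y.card ≤ W.card + n ∧ ∃ C D : G.ComponentCompl (Y : Set V),
      C ≠ D ∧ C.IsTight ∧ D.IsTight ∧ u ∈ C ∧ v ∈ D}.Finite := by
  classical
  -- Here `n` bounds the number of vertices of `Y` outside `W`. While `W` fails to separate `u` from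
  -- `v`, every `Y` contains one of finitely many linking vertices, which is moved into `W`.
  induction n generalizing W with
  | zero =>
    refine (Set.finite_singleton W).subset ?_
    rintro Y ⟨hWY, hc, -⟩
    exact (Finset.eq_of_subset_of_card_le hWY hc).symm
  | succ n ih =>
    by_cases hE : ∃ E : G.ComponentCompl (W : Set V), u ∈ E ∧ v ∈ E
    · obtain ⟨E, hu, hv⟩ := hE
      obtain ⟨P, hPW, hP⟩ := exists_finset_link hu hv
      refine (P.finite_toSet.biUnion fun p _ => ih (insert p W)).subset ?_
      rintro Y ⟨hWY, hc, C, D, hCD, hC, hD, huC, hvD⟩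
      obtain ⟨p, hp, hpY⟩ := hP Y C D hCD huC hvD
      refine Set.mem_biUnion hp ⟨Finset.insert_subset hpY hWY, ?_, C, D, hCD, hC, hD, huC, hvD⟩
      rw [Finset.card_insert_of_notMem (by simpa using hPW p hp)]
      omega
    · refine (Set.finite_singleton W).subset ?_
      rintro Y ⟨hWY, hc, C, D, hCD, hC, hD, huC, hvD⟩
      -- A further vertex of `Y` would have neighbours in both `C` and `D`, joining `u` to `v` in `G
      -- - W`.
      refine Finset.Subset.antisymm (fun y hy => ?_) hWY
      by_contra hyW
      have hsub : ∀ (K : G.ComponentCompl (Y : Set V)), ∀ v ∈ K, v ∉ (W : Set V) :=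
        fun K v hv hvW => notMem_of_mem hv (hWY hvW)
      obtain ⟨E, hCE, hE'⟩ := hC.exists_superset (hsub C)
      obtain ⟨F, hDF, hF'⟩ := hD.exists_superset (hsub D)
      obtain rfl := eq_of_mem (hE' y hy hyW) (hF' y hy hyW)
      exact hE ⟨E, hCE u huC, hDF v hvD⟩

/-- A finite set splits only finitely many tight separators of given size. -/
theorem finite_crossing (G : SimpleGraph V) (X : Finset V) (n : ℕ) :
    {Y : Finset V | G.IsTightSeparator Y ∧ Y.card = n ∧ ¬ G.Unsplit Y X}.Finite := by
  refine ((X.finite_toSet.prod X.finite_toSet).biUnion fun p _ =>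
    finite_tight_separators G p.1 p.2 n ∅).subset ?_
  rintro Y ⟨⟨C, D, hCD, hC, hD⟩, hc, hns⟩
  have hmeet : ∀ K : G.ComponentCompl (Y : Set V), K.IsTight → ∃ x ∈ K, x ∈ (X : Set V) := by
    intro K hK
    by_contra! h
    exact hns (hK.unsplit h)
  obtain ⟨x, hxC, hx⟩ := hmeet C hC
  obtain ⟨y, hyD, hy⟩ := hmeet D hD
  exact Set.mem_biUnion (x := (x, y)) ⟨hx, hy⟩
    ⟨Finset.empty_subset _, by simp [hc], C, D, hCD, hC, hD, hxC, hyD⟩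

/-! ### Smallest separators of two rays -/

namespace Ray

/-- The component of `G - X` in which the ray `R` has a tail. -/
noncomputable def tailComp (R : G.Ray) (X : Finset V) : G.ComponentCompl (X : Set V) :=
  (R.exists_hasTailIn X.finite_toSet).choose

theorem hasTailIn_tailComp (R : G.Ray) (X : Finset V) : R.HasTailIn (R.tailComp X) :=
  (R.exists_hasTailIn X.finite_toSet).choose_spec

theorem HasTailIn.eq_tailComp {R : G.Ray} {X : Finset V} {C : G.ComponentCompl (X : Set V)}
    (h : R.HasTailIn C) : R.tailComp X = C := by
  obtain ⟨n, h1, h2⟩ := ((R.hasTailIn_tailComp X).and h).exists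
  exact eq_of_mem h1 h2

theorem equivalent_iff {R R' : G.Ray} :
    R.Equivalent R' ↔ ∀ X : Finset V, R.tailComp X = R'.tailComp X := by
  constructor
  · intro h X
    obtain ⟨C, h1, h2⟩ := h X X.finite_toSet
    rw [h1.eq_tailComp, h2.eq_tailComp]
  · intro h S hS
    lift S to Finset V using hS
    refine ⟨R.tailComp S, R.hasTailIn_tailComp S, ?_⟩
    rw [h S]
    exact R'.hasTailIn_tailComp S

/-- A set `W` with all its outer neighbours in `X` that contains a tail of `R`, but not of `R'`,
contains the component of `G - X` in which `R` has a tail, and `X` separates `R` from `R'`. -/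
theorem tailComp_of_closed {R R' : G.Ray} {X : Finset V} {W : Set V}
    (hW : ∀ v ∈ W, ∀ w, w ∉ X → G.Adj v w → w ∈ W)
    (hR : ∀ᶠ n in atTop, R.toFun n ∈ W) (hR' : ∀ᶠ n in atTop, R'.toFun n ∉ W) :
    (∀ v ∈ R.tailComp X, v ∈ W) ∧ R.tailComp X ≠ R'.tailComp X := by
  obtain ⟨n, hn, hnW⟩ := ((R.hasTailIn_tailComp X).and hR).exists
  have hsub : ∀ v ∈ R.tailComp X, v ∈ W :=
    forall_mem_of_adj hn hnW fun v w _ hw hvw hv => hW v hv w (notMem_of_mem hw) hvw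
  refine ⟨hsub, fun h => ?_⟩
  obtain ⟨m, hm, hmW⟩ := ((R'.hasTailIn_tailComp X).and hR').exists
  exact hmW (hsub _ (h ▸ hm))

/-- `X` is a smallest vertex set separating `R` from `R'`. -/
def IsMinSeparator (R R' : G.Ray) (X : Finset V) : Prop :=
  R.tailComp X ≠ R'.tailComp X ∧
    ∀ Y : Finset V, R.tailComp Y ≠ R'.tailComp Y → X.card ≤ Y.card

namespace IsMinSeparator

variable {R R' : G.Ray} {X : Finset V}

protected theorem symm (h : IsMinSeparator R R' X) : IsMinSeparator R' R X :=
  ⟨h.1.symm, fun Y hY => h.2 Y hY.symm⟩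

theorem of_card_le (h : IsMinSeparator R R' X) {Y : Finset V}
    (hY : R.tailComp Y ≠ R'.tailComp Y) (hc : Y.card ≤ X.card) : IsMinSeparator R R' Y :=
  ⟨hY, fun Z hZ => hc.trans (h.2 Z hZ)⟩

theorem exists_of_ne {Y : Finset V} (h : R.tailComp Y ≠ R'.tailComp Y) :
    ∃ X, IsMinSeparator R R' X := by
  have hne : {X : Finset V | R.tailComp X ≠ R'.tailComp X}.Nonempty := ⟨Y, h⟩
  refine ⟨Function.argminOn Finset.card _ hne, Function.argminOn_mem Finset.card _ hne,
    fun Z hZ => Function.argminOn_le Finset.card _ (a := Z) hZ⟩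

/-- The vertices of `X` with a neighbour in the component already separate the rays, so by
minimality they are all of `X`. -/
theorem isTight (h : IsMinSeparator R R' X) : (R.tailComp X).IsTight := by
  classical
  set C := R.tailComp X with hC
  set Y := X.filter fun s => ∃ c ∈ C, G.Adj c s with hY
  have hsep : R.tailComp Y ≠ R'.tailComp Y := by
    refine (tailComp_of_closed (R := R) (R' := R') (W := C) ?_ (R.hasTailIn_tailComp X) ?_).2
    · intro v hv w hw hvw
      refine mem_of_adj v w hv (fun hwX => hw ?_) hvw
      exact Finset.mem_filter.2 ⟨hwX, v, hv, hvw⟩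
    · filter_upwards [R'.hasTailIn_tailComp X] with n hn hn'
      exact h.1 (eq_of_mem hn' hn)
  have hYX : Y = X := Finset.eq_of_subset_of_card_le (Finset.filter_subset _ _) (h.2 Y hsep)
  intro s hs
  rw [Finset.mem_coe, ← hYX] at hs
  exact (Finset.mem_filter.1 hs).2

theorem isTightSeparator (h : IsMinSeparator R R' X) : G.IsTightSeparator X :=
  ⟨_, _, h.1, h.isTight, h.symm.isTight⟩

end IsMinSeparator

end Ray

/-! ### Corners and uncrossing -/

open Classical in
/-- The corner of the separators `X` and `Y` at the components `C` of `G - X` and `D` of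
`G - Y`. -/
noncomputable def corner {X Y : Finset V} (C : G.ComponentCompl (X : Set V))
    (D : G.ComponentCompl (Y : Set V)) : Finset V :=
  (X ∪ Y).filter fun v => (v ∈ X ∨ v ∈ C) ∧ (v ∈ Y ∨ v ∈ D)

section corner

variable {X Y : Finset V} {C C' : G.ComponentCompl (X : Set V)}
  {D D' : G.ComponentCompl (Y : Set V)}

theorem mem_corner {v : V} :
    v ∈ corner C D ↔ (v ∈ X ∨ v ∈ Y) ∧ (v ∈ X ∨ v ∈ C) ∧ (v ∈ Y ∨ v ∈ D) := by
  simp [corner]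

theorem corner_subset : (corner C D : Set V) ⊆ (X : Set V) ∪ Y :=
  fun _ hv => (mem_corner.1 hv).1

theorem unsplit_corner_left : G.Unsplit (corner C D : Set V) X := by
  have key : ∀ x ∈ corner C D, ∀ E : G.ComponentCompl (X : Set V), x ∈ E → E = C := by
    intro x hx E hE
    rcases (mem_corner.1 hx).2.1 with h | h
    exacts [absurd h (notMem_of_mem hE), eq_of_mem hE h]
  intro x hx y hy E F hE hF
  rw [key x hx E hE, key y hy F hF]

theorem unsplit_corner_right : G.Unsplit (corner C D : Set V) Y := by
  have key : ∀ x ∈ corner C D, ∀ E : G.ComponentCompl (Y : Set V), x ∈ E → E = D := by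
    intro x hx E hE
    rcases (mem_corner.1 hx).2.2 with h | h
    exacts [absurd h (notMem_of_mem hE), eq_of_mem hE h]
  intro x hx y hy E F hE hF
  rw [key x hx E hE, key y hy F hF]

/-- Opposite corners are submodular. -/
theorem card_corner_add_card_corner_le (hC : C ≠ C') (hD : D ≠ D') :
    (corner C D).card + (corner C' D').card ≤ X.card + Y.card := by
  classical
  rw [← Finset.card_union_add_card_inter, ← Finset.card_union_add_card_inter X Y]
  refine Nat.add_le_add (Finset.card_le_card ?_) (Finset.card_le_card ?_)
  · refine Finset.union_subset ?_ ?_ <;>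
    · intro v hv
      exact Finset.mem_union.2 (mem_corner.1 hv).1
  · intro v hv
    obtain ⟨h, h'⟩ := Finset.mem_inter.1 hv
    obtain ⟨-, h1, h2⟩ := mem_corner.1 h
    obtain ⟨-, h1', h2'⟩ := mem_corner.1 h'
    refine Finset.mem_inter.2 ⟨?_, ?_⟩
    · by_contra hv
      exact hC (eq_of_mem (h1.resolve_left hv) (h1'.resolve_left hv))
    · by_contra hv
      exact hD (eq_of_mem (h2.resolve_left hv) (h2'.resolve_left hv))

/-- The intersection of the two tail components can be left only through the corner. -/
theorem tailComp_corner (R R' : G.Ray)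
    (h : R.tailComp X ≠ R'.tailComp X ∨ R.tailComp Y ≠ R'.tailComp Y) :
    (∀ v ∈ R.tailComp (corner (R.tailComp X) (R.tailComp Y)),
      v ∈ R.tailComp X ∧ v ∈ R.tailComp Y) ∧
    R.tailComp (corner (R.tailComp X) (R.tailComp Y)) ≠
      R'.tailComp (corner (R.tailComp X) (R.tailComp Y)) := by
  refine Ray.tailComp_of_closed (W := {v | v ∈ R.tailComp X ∧ v ∈ R.tailComp Y}) ?_
    ((R.hasTailIn_tailComp X).and (R.hasTailIn_tailComp Y)) ?_
  · rintro v ⟨hv, hv'⟩ w hw hvw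
    rw [mem_corner] at hw
    have h1 : w ∈ X ∨ w ∈ R.tailComp X := or_iff_not_imp_left.2 fun h => mem_of_adj _ _ hv h hvw
    have h2 : w ∈ Y ∨ w ∈ R.tailComp Y := or_iff_not_imp_left.2 fun h => mem_of_adj _ _ hv' h hvw
    have h3 : w ∉ X ∧ w ∉ Y := by tauto
    exact ⟨h1.resolve_left h3.1, h2.resolve_left h3.2⟩
  · filter_upwards [R'.hasTailIn_tailComp X, R'.hasTailIn_tailComp Y] with n h1 h2 hn
    rcases h with h | h
    exacts [h (eq_of_mem hn.1 h1), h (eq_of_mem hn.2 h2)]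

end corner

/-- `Z` and `Z'` behave like opposite corners of the crossing separators `X` and `Y`. -/
structure OppositeCorners (G : SimpleGraph V) (X Y Z Z' : Finset V) : Prop where
  subset : (Z : Set V) ⊆ (X : Set V) ∪ Y
  subset' : (Z' : Set V) ⊆ (X : Set V) ∪ Y
  left : G.Unsplit Z X
  left' : G.Unsplit Z' X
  right : G.Unsplit Z Y
  right' : G.Unsplit Z' Y
  unsplit_of_left : ∀ U : Set V, G.Unsplit U X → G.Unsplit Z U ∨ G.Unsplit Z' U
  unsplit_of_right : ∀ U : Set V, G.Unsplit U Y → G.Unsplit Z U ∨ G.Unsplit Z' U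

open Ray

/-- If the rays `A` and `B` live in opposite corners of `X` and `Y`, and `A'` and `B'` outside
the respective corner, then these corners are smallest separators of `A` and `A'` and of `B` and
`B'`, provided that `X` and `Y` are small enough. -/
theorem exists_oppositeCorners {A A' B B' : G.Ray} {X Y : Finset V}
    (hX : A.tailComp X ≠ B.tailComp X) (hY : A.tailComp Y ≠ B.tailComp Y)
    (hA : A.tailComp X ≠ A'.tailComp X ∨ A.tailComp Y ≠ A'.tailComp Y)
    (hB : B.tailComp X ≠ B'.tailComp X ∨ B.tailComp Y ≠ B'.tailComp Y)
    {m n : ℕ} (hm : ∀ Z : Finset V, A.tailComp Z ≠ A'.tailComp Z → m ≤ Z.card)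
    (hn : ∀ Z : Finset V, B.tailComp Z ≠ B'.tailComp Z → n ≤ Z.card)
    (hmn : X.card + Y.card ≤ m + n) :
    ∃ Z Z' : Finset V, G.OppositeCorners X Y Z Z' ∧
      IsMinSeparator A A' Z ∧ IsMinSeparator B B' Z' ∧ Z.card = m ∧ Z'.card = n := by
  obtain ⟨hAs, hAc⟩ := tailComp_corner A A' hA
  obtain ⟨hBs, hBc⟩ := tailComp_corner B B' hB
  set Z := corner (A.tailComp X) (A.tailComp Y) with hZ
  set Z' := corner (B.tailComp X) (B.tailComp Y) with hZ'
  -- With the lower bounds `m` and `n`, submodularity leaves no slack, so both corners have minimum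
  -- size.
  have hcard : Z.card + Z'.card ≤ X.card + Y.card := card_corner_add_card_corner_le hX hY
  have h1 := hm Z hAc
  have h2 := hn Z' hBc
  have hZm : Z.card = m := by omega
  have hZn : Z'.card = n := by omega
  have hAm : IsMinSeparator A A' Z := ⟨hAc, hZm ▸ hm⟩
  have hBm : IsMinSeparator B B' Z' := ⟨hBc, hZn ▸ hn⟩
  refine ⟨Z, Z', ⟨corner_subset, corner_subset, unsplit_corner_left, unsplit_corner_left,
    unsplit_corner_right, unsplit_corner_right, fun U hU => ?_, fun U hU => ?_⟩,
    hAm, hBm, hZm, hZn⟩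
  · refine (hU.avoids hX).imp (fun h => ?_) fun h => ?_
    · exact hAm.isTight.unsplit fun v hv => h v (hAs v hv).1
    · exact hBm.isTight.unsplit fun v hv => h v (hBs v hv).1
  · refine (hU.avoids hY).imp (fun h => ?_) fun h => ?_
    · exact hAm.isTight.unsplit fun v hv => h v (hAs v hv).2
    · exact hBm.isTight.unsplit fun v hv => h v (hBs v hv).2

/-- Swapping names within each pair places `Q` and `R` in different components of both `G - X` and
`G - Y`; `X` then separates `Q` from `Q'` and `Y` separates `R` from `R'`. -/
theorem exists_oppositeCorners_of_eq {Q Q' R R' : G.Ray} {X Y : Finset V}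
    (hX : IsMinSeparator Q Q' X) (hY : IsMinSeparator R R' Y)
    (h : R.tailComp X = R'.tailComp X) :
    ∃ Z Z' : Finset V, G.OppositeCorners X Y Z Z' ∧
      IsMinSeparator Q Q' Z ∧ IsMinSeparator R R' Z' := by
  wlog hQ : Q.tailComp X ≠ R.tailComp X generalizing Q Q'
  · push Not at hQ
    obtain ⟨Z, Z', h1, h2, h3⟩ := this hX.symm (hQ ▸ hX.1.symm)
    exact ⟨Z, Z', h1, h2.symm, h3⟩
  wlog hR : Q.tailComp Y ≠ R.tailComp Y generalizing R R'
  · push Not at hR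
    obtain ⟨Z, Z', h1, h2, h3⟩ := this hY.symm h.symm (h ▸ hQ) (hR ▸ hY.1)
    exact ⟨Z, Z', h1, h2, h3.symm⟩
  obtain ⟨Z, Z', h1, h2, h3, -⟩ :=
    exists_oppositeCorners hQ hR (Or.inl hX.1) (Or.inr hY.1) hX.2 hY.2 le_rfl
  exact ⟨Z, Z', h1, h2, h3⟩

/-! ### Minimising crossings -/

/-- The tight separators of size `k` that are split by `X`. -/
def crossing (G : SimpleGraph V) (k : ℕ) (X : Finset V) : Set (Finset V) :=
  {U | G.IsTightSeparator U ∧ U.card = k ∧ ¬ G.Unsplit U X}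

theorem OppositeCorners.unsplit {X Y Z Z' : Finset V} (h : G.OppositeCorners X Y Z Z')
    (hX : G.IsTightSeparator X) (hY : G.IsTightSeparator Y) (hYX : ¬ G.Unsplit Y X)
    {U : Set V} (hU : G.IsTightSeparator U) (hUX : G.Unsplit U X) (hUY : G.Unsplit U Y) :
    G.Unsplit U Z ∧ G.Unsplit U Z' :=
  ⟨(Unsplit.of_subset_union hY hYX h.subset (hUX.symm hX) hUY).symm hU,
    (Unsplit.of_subset_union hY hYX h.subset' (hUX.symm hX) hUY).symm hU⟩

/-- A separator crossing a corner crosses `X` or `Y`, and one crossing both corners crosses both `X`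
and `Y`. The inequality is strict because `Y` crosses `X` but neither corner. -/
theorem OppositeCorners.ncard_crossing_lt {X Y Z Z' : Finset V} {k : ℕ}
    (h : G.OppositeCorners X Y Z Z')
    (hX : G.IsTightSeparator X) (hY : G.IsTightSeparator Y) (hYX : ¬ G.Unsplit Y X)
    (hk : Y.card = k) :
    (G.crossing k Z).ncard + (G.crossing k Z').ncard <
      (G.crossing k X).ncard + (G.crossing k Y).ncard := by
  have hfin : ∀ W, (G.crossing k W).Finite := fun W => finite_crossing G W k
  rw [← Set.ncard_union_add_ncard_inter _ _ (hfin Z) (hfin Z'),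
    ← Set.ncard_union_add_ncard_inter _ _ (hfin X) (hfin Y)]
  refine add_lt_add_of_lt_of_le (Set.ncard_lt_ncard ?_ ((hfin X).union (hfin Y)))
    (Set.ncard_le_ncard ?_ ((hfin X).inter_of_left _))
  · refine (Set.ssubset_iff_of_subset ?_).2 ⟨Y, Or.inl ⟨hY, hk, hYX⟩, ?_⟩
    · intro U hU
      by_contra hne
      have hU' : G.IsTightSeparator U ∧ U.card = k := hU.elim (fun h => ⟨h.1, h.2.1⟩)
        fun h => ⟨h.1, h.2.1⟩
      have hUX : G.Unsplit U X := by
        by_contra hn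
        exact hne (Or.inl ⟨hU'.1, hU'.2, hn⟩)
      have hUY : G.Unsplit U Y := by
        by_contra hn
        exact hne (Or.inr ⟨hU'.1, hU'.2, hn⟩)
      have := h.unsplit hX hY hYX hU'.1 hUX hUY
      exact hU.elim (fun h => h.2.2 this.1) fun h => h.2.2 this.2
    · rintro (hU | hU)
      exacts [hU.2.2 (h.right.symm hY), hU.2.2 (h.right'.symm hY)]
  · rintro U ⟨⟨hU, hUk, hUZ⟩, -, -, hUZ'⟩
    have hne : ¬ (G.Unsplit Z U ∨ G.Unsplit Z' U) := by
      rintro (h | h)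
      exacts [hUZ (h.symm hU), hUZ' (h.symm hU)]
    exact ⟨⟨hU, hUk, fun hn => hne (h.unsplit_of_left U hn)⟩,
      hU, hUk, fun hn => hne (h.unsplit_of_right U hn)⟩

/-- `X` is a smallest separator of `R` and `R'` that is nested with all separators in `M`. -/
def IsNestedMinSeparator (M : Set (Finset V)) (R R' : G.Ray) (X : Finset V) : Prop :=
  IsMinSeparator R R' X ∧ ∀ Y ∈ M, G.Unsplit Y X

/-- `X` is a smallest separator of `R` and `R'` that is nested with all separators in `M`, and
amongst these it crosses as few tight separators of size `k` as possible. -/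
def IsOptimalSeparator (M : Set (Finset V)) (k : ℕ) (R R' : G.Ray) (X : Finset V) : Prop :=
  IsNestedMinSeparator M R R' X ∧ ∀ X', IsNestedMinSeparator M R R' X' →
    (G.crossing k X).ncard ≤ (G.crossing k X').ncard

theorem IsNestedMinSeparator.exists_isOptimalSeparator {M : Set (Finset V)} {R R' : G.Ray}
    {X : Finset V} (h : IsNestedMinSeparator M R R' X) (k : ℕ) :
    ∃ X, IsOptimalSeparator M k R R' X := by
  have hne : {X : Finset V | IsNestedMinSeparator M R R' X}.Nonempty := ⟨X, h⟩
  exact ⟨Function.argminOn (fun X => (G.crossing k X).ncard) _ hne,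
    Function.argminOn_mem (fun X => (G.crossing k X).ncard) _ hne,
    fun Z hZ => Function.argminOn_le (fun X => (G.crossing k X).ncard) _ (a := Z) hZ⟩

theorem IsOptimalSeparator.unsplit {M : Set (Finset V)} (hM : ∀ Y ∈ M, G.IsTightSeparator Y)
    {Q Q' R R' : G.Ray} {X Y : Finset V} {k : ℕ} (hX : IsOptimalSeparator M k Q Q' X)
    (hY : IsOptimalSeparator M k R R' Y) (hXk : X.card = k) (hYk : Y.card = k) :
    G.Unsplit Y X := by
  by_contra hYX
  have hXt := hX.1.1.isTightSeparator
  have hYt := hY.1.1.isTightSeparator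
  have hXY : ¬ G.Unsplit X Y := fun h => hYX (h.symm hYt)
  by_cases hR : R.tailComp X = R'.tailComp X
  · obtain ⟨Z, Z', ho, hZ, hZ'⟩ := exists_oppositeCorners_of_eq hX.1.1 hY.1.1 hR
    have hlt := ho.ncard_crossing_lt hXt hYt hYX hYk
    have hu := fun U hU => ho.unsplit hXt hYt hYX (hM U hU) (hX.1.2 U hU) (hY.1.2 U hU)
    have h1 := hX.2 Z ⟨hZ, fun U hU => (hu U hU).1⟩
    have h2 := hY.2 Z' ⟨hZ', fun U hU => (hu U hU).2⟩
    omega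
  by_cases hQ : Q.tailComp Y = Q'.tailComp Y
  · obtain ⟨Z, Z', ho, hZ, hZ'⟩ := exists_oppositeCorners_of_eq hY.1.1 hX.1.1 hQ
    have hlt := ho.ncard_crossing_lt hYt hXt hXY hXk
    have hu := fun U hU => ho.unsplit hYt hXt hXY (hM U hU) (hY.1.2 U hU) (hX.1.2 U hU)
    have h1 := hY.2 Z ⟨hZ, fun U hU => (hu U hU).1⟩
    have h2 := hX.2 Z' ⟨hZ', fun U hU => (hu U hU).2⟩
    omega
  -- Now both sets separate both pairs. Both corners compete with `X` for `Q` and `Q'`, while `X`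
  -- competes with `Y` for `R` and `R'`; the three inequalities contradict the strict one.
  have hXm : IsMinSeparator R R' X := hY.1.1.of_card_le hR (hXk.trans hYk.symm).le
  have hYm : IsMinSeparator Q Q' Y := hX.1.1.of_card_le hQ (hYk.trans hXk.symm).le
  obtain ⟨Z, Z', ho, hZ, hZ', -⟩ := exists_oppositeCorners hX.1.1.1 hQ (Or.inl hX.1.1.1)
    (Or.inl hX.1.1.symm.1) hX.1.1.2 hX.1.1.symm.2 (by omega)
  have hlt := ho.ncard_crossing_lt hXt hYt hYX hYk
  have hu := fun U hU => ho.unsplit hXt hYt hYX (hM U hU) (hX.1.2 U hU) (hY.1.2 U hU)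
  have h1 := hX.2 Z ⟨hZ, fun U hU => (hu U hU).1⟩
  have h2 := hX.2 Z' ⟨hZ'.symm, fun U hU => (hu U hU).2⟩
  have h3 := hY.2 X ⟨hXm, hX.1.2⟩
  omega

/-- A nested set of separators smaller than the smallest separators of `R` and `R'` is nested
with one of these. -/
theorem exists_isNestedMinSeparator {M : Set (Finset V)} {k : ℕ} {R R' : G.Ray}
    (hM : ∀ Y ∈ M, Y.card < k ∧ ∃ Q Q' : G.Ray, IsMinSeparator Q Q' Y)
    (hMn : ∀ X ∈ M, ∀ Y ∈ M, G.Unsplit X Y) {X : Finset V} (hX : IsMinSeparator R R' X)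
    (hk : k ≤ X.card) : ∃ X, IsNestedMinSeparator M R R' X := by
  let cr : Finset V → Set (Finset V) := fun X => {U | U ∈ M ∧ ¬ G.Unsplit U X}
  have hfin : ∀ X, (cr X).Finite := by
    intro X
    refine ((Set.finite_Iio k).biUnion fun j _ => finite_crossing G X j).subset ?_
    rintro U ⟨hU, hn⟩
    obtain ⟨hc, Q, Q', hQ⟩ := hM U hU
    exact Set.mem_biUnion hc ⟨hQ.isTightSeparator, rfl, hn⟩
  have hne : {X : Finset V | IsMinSeparator R R' X}.Nonempty := ⟨X, hX⟩
  let Y := Function.argminOn (fun X => (cr X).ncard) _ hne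
  have hY : IsMinSeparator R R' Y := Function.argminOn_mem (fun X => (cr X).ncard) _ hne
  have hmin : ∀ Z, IsMinSeparator R R' Z → (cr Y).ncard ≤ (cr Z).ncard :=
    fun Z hZ => Function.argminOn_le (fun X => (cr X).ncard) _ (a := Z) hZ
  refine ⟨Y, hY, fun W hW => ?_⟩
  by_contra hWY
  obtain ⟨hWk, Q, Q', hQ⟩ := hM W hW
  have hYt := hY.isTightSeparator
  have hWt := hQ.isTightSeparator
  have hYW : ¬ G.Unsplit Y W := fun h => hWY (h.symm hWt)
  have hXY := hX.2 Y hY.1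
  have hR : R.tailComp W = R'.tailComp W := by
    by_contra hne
    have := hX.2 W hne
    omega
  obtain ⟨Z, Z', ho, -, hZ'⟩ := exists_oppositeCorners_of_eq hQ hY hR
  -- As `M` is nested, members not crossing `Y` do not cross `Z'`; `W` crosses `Y` but not `Z'`.
  refine (hmin Z' hZ').not_gt (Set.ncard_lt_ncard ?_ (hfin Y))
  refine (Set.ssubset_iff_of_subset ?_).2 ⟨W, ⟨hW, hWY⟩, fun h => h.2 (ho.left'.symm hWt)⟩
  rintro U ⟨hU, hUZ⟩
  refine ⟨hU, fun hUY => hUZ ?_⟩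
  obtain ⟨-, P, P', hP⟩ := hM U hU
  exact (ho.unsplit hWt hYt hYW hP.isTightSeparator (hMn U hU W hW) hUY).2

/-! ### Recursion on the size -/

/-- The separators of size less than `k` of a nested set of separators, constructed by
recursion on their size. -/
def nestedSeparators (G : SimpleGraph V) : ℕ → Set (Finset V)
  | 0 => ∅
  | k + 1 => nestedSeparators G k ∪
      {X | X.card = k ∧ ∃ R R' : G.Ray, IsOptimalSeparator (nestedSeparators G k) k R R' X}

theorem nestedSeparators_isMinSeparator {k : ℕ} {X : Finset V} (hX : X ∈ G.nestedSeparators k) :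
    X.card < k ∧ ∃ R R' : G.Ray, IsMinSeparator R R' X := by
  induction k with
  | zero => exact hX.elim
  | succ k ih =>
    rcases hX with hX | ⟨hc, R, R', hX⟩
    · exact ⟨(ih hX).1.trans (Nat.lt_succ_self k), (ih hX).2⟩
    · exact ⟨hc ▸ Nat.lt_succ_self k, R, R', hX.1.1⟩

theorem nestedSeparators_isTightSeparator {k : ℕ} {X : Finset V}
    (hX : X ∈ G.nestedSeparators k) : G.IsTightSeparator X := by
  obtain ⟨-, R, R', h⟩ := nestedSeparators_isMinSeparator hX
  exact h.isTightSeparator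

theorem nestedSeparators_unsplit {k : ℕ} {X Y : Finset V} (hX : X ∈ G.nestedSeparators k)
    (hY : Y ∈ G.nestedSeparators k) : G.Unsplit X Y := by
  induction k with
  | zero => exact hX.elim
  | succ k ih =>
    rcases hX with hX | ⟨hXc, Q, Q', hX⟩ <;> rcases hY with hY | ⟨hYc, R, R', hY⟩
    · exact ih hX hY
    · exact hY.1.2 X hX
    · exact (hX.1.2 Y hY).symm hX.1.1.isTightSeparator
    · exact hY.unsplit (fun _ => nestedSeparators_isTightSeparator) hX hYc hXc

theorem nestedSeparators_mono : Monotone G.nestedSeparators :=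
  monotone_nat_of_le_succ fun _ => Set.subset_union_left

theorem exists_mem_nestedSeparators {R R' : G.Ray} {X : Finset V} (hX : IsMinSeparator R R' X) :
    ∃ Y ∈ G.nestedSeparators (X.card + 1), IsMinSeparator R R' Y := by
  obtain ⟨Y, hY⟩ := exists_isNestedMinSeparator (M := G.nestedSeparators X.card)
    (fun _ => nestedSeparators_isMinSeparator) (fun _ h _ h' => nestedSeparators_unsplit h h')
    hX le_rfl
  obtain ⟨Z, hZ⟩ := hY.exists_isOptimalSeparator X.card
  exact ⟨Z, Or.inr ⟨(hZ.1.1.2 X hX.1).antisymm (hX.2 Z hZ.1.1.1), R, R', hZ⟩, hZ.1.1⟩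

/-- There is a nested set of separators that contains a smallest separator of any two
inequivalent rays. -/
theorem exists_nested_separators (G : SimpleGraph V) :
    ∃ N : Set (Finset V), (∀ X ∈ N, ∀ Y ∈ N, G.Unsplit X Y) ∧
      ∀ R R' : G.Ray, ¬ R.Equivalent R' → ∃ X ∈ N, IsMinSeparator R R' X := by
  refine ⟨⋃ k, G.nestedSeparators k, fun X hX Y hY => ?_, fun R R' h => ?_⟩
  · obtain ⟨i, hi⟩ := Set.mem_iUnion.1 hX
    obtain ⟨j, hj⟩ := Set.mem_iUnion.1 hY
    exact nestedSeparators_unsplit (nestedSeparators_mono (le_max_left i j) hi)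
      (nestedSeparators_mono (le_max_right i j) hj)
  · rw [equivalent_iff] at h
    push Not at h
    obtain ⟨Y, hY⟩ := h
    obtain ⟨X, hX⟩ := IsMinSeparator.exists_of_ne hY
    obtain ⟨Z, hZ, hZ'⟩ := exists_mem_nestedSeparators hX
    exact ⟨Z, Set.mem_iUnion.2 ⟨_, hZ⟩, hZ'⟩

/-! ### Discarding one component per separator -/

/-- The well-order picks `C` from the components of `G - X`: it is tight, and meets the first
member of `N` that meets a tight component of `G - X`. -/
def IsSelected (N : Set (Finset V)) (X : Finset V) (C : G.ComponentCompl (X : Set V)) : Prop :=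
  C.IsTight ∧ ∃ T ∈ N, (∃ v ∈ C, v ∈ T) ∧ ∀ T' ∈ N, ∀ C' : G.ComponentCompl (X : Set V),
    C'.IsTight → (∃ v ∈ C', v ∈ T') → ¬ WellOrderingRel T' T

theorem exists_isSelected {N : Set (Finset V)} {X Y : Finset V}
    {C : G.ComponentCompl (X : Set V)} (hC : C.IsTight) (hY : Y ∈ N) (hYC : ∃ v ∈ C, v ∈ Y) :
    ∃ C' : G.ComponentCompl (X : Set V), IsSelected N X C' := by
  let A : Set (Finset V) := {T | T ∈ N ∧ ∃ C : G.ComponentCompl (X : Set V),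
    C.IsTight ∧ ∃ v ∈ C, v ∈ T}
  obtain ⟨T, ⟨hT, C', hC', hTC'⟩, hmin⟩ :=
    (IsWellFounded.wf (r := WellOrderingRel (α := Finset V))).has_min A ⟨Y, hY, C, hC, hYC⟩
  exact ⟨C', hC', T, hT, hTC', fun T' hT' D hD hTD => hmin T' ⟨hT', D, hD, hTD⟩⟩

/-- Both components meet the same first member of `N`, which `X` does not split. -/
theorem IsSelected.eq {N : Set (Finset V)} (hN : ∀ X ∈ N, ∀ Y ∈ N, G.Unsplit X Y)
    {X : Finset V} (hX : X ∈ N) {C D : G.ComponentCompl (X : Set V)} (hC : IsSelected N X C)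
    (hD : IsSelected N X D) : C = D := by
  obtain ⟨hCt, T, hT, ⟨v, hvC, hvT⟩, hTm⟩ := hC
  obtain ⟨hDt, U, hU, ⟨w, hwD, hwU⟩, hUm⟩ := hD
  obtain rfl : T = U := by
    rcases trichotomous_of WellOrderingRel T U with h | h | h
    exacts [absurd h (hUm T hT C hCt ⟨v, hvC, hvT⟩), h, absurd h (hTm U hU D hDt ⟨w, hwD, hwU⟩)]
  exact hN T hT X hX hvT hwU hvC hwD

/-- If `X` and `Y` meet tight components of each other, then one of these is selected. -/
theorem isSelected_or_isSelected {N : Set (Finset V)}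
    (hN : ∀ X ∈ N, ∀ Y ∈ N, G.Unsplit X Y) {X Y : Finset V} (hX : X ∈ N) (hY : Y ∈ N)
    {C : G.ComponentCompl (X : Set V)} {D : G.ComponentCompl (Y : Set V)}
    (hC : C.IsTight) (hD : D.IsTight) (hYC : ∃ v ∈ C, v ∈ Y) (hXD : ∃ v ∈ D, v ∈ X) :
    IsSelected N X C ∨ IsSelected N Y D := by
  -- Since `Y` meets `C`, it avoids `C'`; tightness then puts `C'` inside `D`.
  have key : ∀ {X Y : Finset V}, X ∈ N → Y ∈ N → ∀ {C C' : G.ComponentCompl (X : Set V)}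
      {D : G.ComponentCompl (Y : Set V)}, C'.IsTight → C ≠ C' → (∃ v ∈ C, v ∈ Y) →
      (∃ v ∈ D, v ∈ X) → ∀ T : Finset V, (∃ v ∈ C', v ∈ T) → ∃ v ∈ D, v ∈ T := by
    rintro X Y hX hY C C' D hC' hne ⟨v, hvC, hvY⟩ ⟨w, hwD, hwX⟩ T ⟨t, htC', htT⟩
    have hav := ((hN Y hY X hX).avoids hne).resolve_left fun h => h v hvC hvY
    obtain ⟨E, hE, hXE⟩ := hC'.exists_superset hav
    obtain rfl := eq_of_mem (hXE w hwX (notMem_of_mem hwD)) hwD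
    exact ⟨t, hE t htC', htT⟩
  obtain ⟨C', hC't, T, hT, hTC', hTm⟩ := exists_isSelected hC hY hYC
  obtain ⟨D', hD't, U, hU, hUD', hUm⟩ := exists_isSelected hD hX hXD
  by_cases hCC : C = C'
  · exact Or.inl (hCC ▸ ⟨hC't, T, hT, hTC', hTm⟩)
  by_cases hDD : D = D'
  · exact Or.inr (hDD ▸ ⟨hD't, U, hU, hUD', hUm⟩)
  exfalso
  have hTD := key hX hY hC't hCC hYC hXD T hTC'
  have hUC := key hY hX hD't hDD hXD hYC U hUD'
  -- `T` meets `D` and `U` meets `C`, so neither precedes the other. Their common value then meets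
  -- both `D` and `D'`, although `Y` does not split it.
  obtain rfl : T = U := by
    rcases trichotomous_of WellOrderingRel T U with h | h | h
    exacts [absurd h (hUm T hT D hD hTD), h, absurd h (hTm U hU C hC hUC)]
  obtain ⟨v, hvD, hvT⟩ := hTD
  obtain ⟨w, hwD, hwT⟩ := hUD'
  exact hDD (hN T hT Y hY hvT hwT hvD hwD)

theorem Ray.exists_tail (R : G.Ray) (N : ℕ) :
    ∃ R' : G.Ray, R'.Equivalent R ∧ ∀ n, R'.toFun n = R.toFun (n + N) := by
  refine ⟨⟨fun n => R.toFun (n + N), fun m n h => Nat.add_right_cancel (R.injective h),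
    fun n => by simpa [Nat.add_right_comm] using R.adj (n + N)⟩, fun S hS => ?_, fun _ => rfl⟩
  obtain ⟨C, hC⟩ := R.exists_hasTailIn hS
  exact ⟨C, (tendsto_add_atTop_nat N).eventually hC, hC⟩

/-! ### From vertex separators to edge separations -/

namespace EdgeSeparation

/-- The set of edges incident with a vertex in `C`. -/
def incident (G : SimpleGraph V) (C : Set V) : G.EdgeSeparation :=
  {e | ∃ v ∈ C, v ∈ (e : Sym2 V)}

theorem adj_of_mem {e : G.edgeSet} {v w : V} (hv : v ∈ (e : Sym2 V)) (hw : w ∈ (e : Sym2 V))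
    (h : v ≠ w) : G.Adj v w := by
  have := e.2
  rwa [(Sym2.mem_and_mem_iff h).1 ⟨hv, hw⟩] at this

theorem boundary_incident_subset {S : Set V} (C : G.ComponentCompl S) :
    boundary (incident G (C : Set V)) ⊆ S := by
  rintro v ⟨⟨e, ⟨c, hc, hce⟩, hve⟩, f, hf, hvf⟩
  by_contra hvS
  have hvC : v ∉ C := fun h => hf ⟨v, h, hvf⟩
  have hne : c ≠ v := by
    rintro rfl
    exact hvC hc
  exact hvC (mem_of_adj c v hc hvS (adj_of_mem hce hve hne))

theorem order_incident_le {X : Finset V} (C : G.ComponentCompl (X : Set V)) :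
    order (incident G (C : Set V)) ≤ X.card := by
  rw [← Set.encard_coe_eq_coe_finsetCard]
  exact Set.encard_le_encard (boundary_incident_subset C)

theorem finiteOrder_incident {X : Finset V} (C : G.ComponentCompl (X : Set V)) :
    FiniteOrder (incident G (C : Set V)) :=
  (order_incident_le C).trans_lt (ENat.natCast_lt_top _)

theorem Nested.symm {X Y : G.EdgeSeparation} (h : Nested X Y) : Nested Y X := by
  rcases h with h | h | h | h
  · exact Or.inr (Or.inr (Or.inl h))
  · exact Or.inr (Or.inl (Set.compl_subset_comm.1 h))
  · exact Or.inl h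
  · exact Or.inr (Or.inr (Or.inr (Set.subset_compl_comm.1 h)))

/-- `C` lies in a single component of `G - T`: either `D`, or one that shares no edge with `D`. -/
theorem nested_incident {S T : Set V} (C : G.ComponentCompl S) (D : G.ComponentCompl T)
    (h : ∀ v ∈ C, v ∉ T) : Nested (incident G (C : Set V)) (incident G (D : Set V)) := by
  obtain ⟨E, hE, -⟩ := C.exists_superset h
  by_cases hED : E = D
  · left
    rintro e ⟨v, hv, hve⟩
    exact ⟨v, hED ▸ hE v hv, hve⟩
  · refine Or.inr (Or.inr (Or.inr ?_))
    rintro e ⟨d, hd, hde⟩ ⟨c, hc, hce⟩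
    by_cases hcd : c = d
    · subst hcd
      exact hED (eq_of_mem (hE c hc) hd)
    · exact hED (eq_of_mem (mem_of_adj c d (hE c hc) (notMem_of_mem hd)
        (adj_of_mem hce hde hcd)) hd)

theorem mem_verts_of_adj {X : G.EdgeSeparation} {v w : V} (h : G.Adj v w)
    (hX : (⟨s(v, w), h⟩ : G.edgeSet) ∈ X) : v ∈ verts X :=
  ⟨_, hX, Sym2.mem_mk_left v w⟩

theorem lives_incident {R : G.Ray} {S : Set V} {C : G.ComponentCompl S} (h : R.HasTailIn C) :
    Lives (Quotient.mk G.raySetoid R) (incident G (C : Set V)) := by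
  obtain ⟨N, hN⟩ := eventually_atTop.1 h
  obtain ⟨R', hR', hn⟩ := R.exists_tail N
  refine ⟨R', Quotient.sound hR', fun n => mem_verts_of_adj (R'.adj n)
    ⟨R'.toFun n, ?_, Sym2.mem_mk_left _ _⟩⟩
  rw [hn]
  exact hN _ (Nat.le_add_left N n)

theorem lives_compl_incident {R : G.Ray} {S : Set V} {C D : G.ComponentCompl S} (hCD : C ≠ D)
    (h : R.HasTailIn D) :
    Lives (Quotient.mk G.raySetoid R) (incident G (C : Set V))ᶜ := by
  obtain ⟨N, hN⟩ := eventually_atTop.1 h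
  obtain ⟨R', hR', hn⟩ := R.exists_tail N
  have hD : ∀ n, R'.toFun n ∈ D := fun n => hn n ▸ hN _ (Nat.le_add_left N n)
  refine ⟨R', Quotient.sound hR', fun n => mem_verts_of_adj (R'.adj n) ?_⟩
  rintro ⟨v, hvC, hv⟩
  rcases Sym2.mem_iff.1 hv with rfl | rfl
  exacts [hCD (eq_of_mem hvC (hD n)), hCD (eq_of_mem hvC (hD (n + 1)))]

/-- The boundary of a separation distinguishing two ends separates their rays. -/
theorem tailComp_ne_of_boundary {R R' : G.Ray} {Y : G.EdgeSeparation} {B : Finset V}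
    (hB : (B : Set V) = boundary Y) (hR : ∀ n, R.toFun n ∈ verts Y)
    (hR' : ∀ n, R'.toFun n ∈ verts Yᶜ) : R.tailComp B ≠ R'.tailComp B := by
  have hmem : ∀ v, v ∈ verts Y → v ∈ verts Yᶜ → v ∈ B := by
    intro v h h'
    rw [← Finset.mem_coe, hB]
    exact ⟨h, h'⟩
  -- An edge from this set to a vertex outside `verts Y` would lie in `Yᶜ`, putting its first end in
  -- the boundary.
  refine (tailComp_of_closed (W := {v | v ∉ B ∧ v ∈ verts Y}) ?_ ?_ ?_).2
  · rintro v ⟨hvB, hv⟩ w hw hvw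
    refine ⟨hw, ?_⟩
    by_contra hwY
    refine hvB (hmem v hv (mem_verts_of_adj hvw fun he => hwY ⟨_, he, Sym2.mem_mk_right v w⟩))
  · filter_upwards [R.hasTailIn_tailComp B] with n hn
    exact ⟨notMem_of_mem hn, hR n⟩
  · exact Eventually.of_forall fun n hn => hn.1 (hmem _ hn.2 (hR' n))

theorem card_le_order {R R' : G.Ray} {X : Finset V} (hX : IsMinSeparator R R' X)
    {Y : G.EdgeSeparation}
    (hY : Distinguishes Y (Quotient.mk G.raySetoid R) (Quotient.mk G.raySetoid R')) :
    (X.card : ℕ∞) ≤ order Y := by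
  obtain ⟨hfin, hY⟩ := hY
  obtain ⟨B, hB⟩ := (Set.encard_lt_top_iff.1 hfin).exists_finset_coe
  rw [order, ← hB, Set.encard_coe_eq_coe_finsetCard, Nat.cast_le]
  have key : ∀ {R R' : G.Ray}, Lives (Quotient.mk G.raySetoid R) Y →
      Lives (Quotient.mk G.raySetoid R') Yᶜ → R.tailComp B ≠ R'.tailComp B := by
    rintro R R' ⟨Q, hQR, hQ⟩ ⟨Q', hQR', hQ'⟩
    have h1 : Q.Equivalent R := Quotient.exact hQR
    have h2 : Q'.Equivalent R' := Quotient.exact hQR'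
    rw [← equivalent_iff.1 h1, ← equivalent_iff.1 h2]
    exact tailComp_ne_of_boundary hB hQ hQ'
  rcases hY with ⟨h1, h2⟩ | ⟨h1, h2⟩
  exacts [hX.2 B (key h1 h2), hX.2 B (key h1 h2).symm]

theorem Distinguishes.symm {X : G.EdgeSeparation} {ω μ : G.VertexEnd}
    (h : Distinguishes X ω μ) : Distinguishes X μ ω :=
  ⟨h.1, h.2.symm⟩

theorem DistinguishesEfficiently.symm {X : G.EdgeSeparation} {ω μ : G.VertexEnd}
    (h : DistinguishesEfficiently X ω μ) : DistinguishesEfficiently X μ ω :=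
  ⟨h.1.symm, fun Y hY => h.2 Y hY.symm⟩

theorem distinguishesEfficiently_incident {R R' : G.Ray} {X : Finset V}
    (hX : IsMinSeparator R R' X) :
    DistinguishesEfficiently (incident G (R.tailComp X : Set V))
      (Quotient.mk G.raySetoid R) (Quotient.mk G.raySetoid R') :=
  ⟨⟨finiteOrder_incident _, Or.inl ⟨lives_incident (R.hasTailIn_tailComp X),
    lives_compl_incident hX.1 (R'.hasTailIn_tailComp X)⟩⟩,
    fun _ hY => (order_incident_le _).trans (card_le_order hX hY)⟩

end EdgeSeparation

end SimpleGraph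

theorem mainTheorem4 {V : Type*} (G : SimpleGraph V) :
    ∃ N : Set G.EdgeSeparation,
      (∀ X ∈ N, SimpleGraph.EdgeSeparation.FiniteOrder X) ∧
      (∀ X ∈ N, ∀ Y ∈ N, SimpleGraph.EdgeSeparation.Nested X Y) ∧
      ∀ ω μ : G.VertexEnd, ω ≠ μ →
        ∃ X ∈ N, SimpleGraph.EdgeSeparation.DistinguishesEfficiently X ω μ := by
  obtain ⟨M, hM, hsep⟩ := SimpleGraph.exists_nested_separators G
  refine ⟨{E | ∃ X ∈ M, ∃ C : G.ComponentCompl (X : Set V), C.IsTight ∧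
    ¬ SimpleGraph.IsSelected M X C ∧ E = SimpleGraph.EdgeSeparation.incident G (C : Set V)},
    ?_, ?_, ?_⟩
  · rintro _ ⟨X, -, C, -, -, rfl⟩
    exact SimpleGraph.EdgeSeparation.finiteOrder_incident C
  · rintro _ ⟨X, hX, C, hC, hCs, rfl⟩ _ ⟨Y, hY, D, hD, hDs, rfl⟩
    by_cases hYC : ∃ v ∈ C, v ∈ Y
    · by_cases hXD : ∃ v ∈ D, v ∈ X
      · exact ((SimpleGraph.isSelected_or_isSelected hM hX hY hC hD hYC hXD).elim hCs hDs).elim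
      · push Not at hXD
        exact (SimpleGraph.EdgeSeparation.nested_incident D C hXD).symm
    · push Not at hYC
      exact SimpleGraph.EdgeSeparation.nested_incident C D hYC
  · intro ω μ
    refine Quotient.inductionOn₂ ω μ fun R R' hne => ?_
    obtain ⟨X, hX, hR⟩ := hsep R R' fun h => hne (Quotient.sound h)
    -- At most one component of `G - X` is selected, so the component of `R` or that of `R'`
    -- remains.
    by_cases hs : SimpleGraph.IsSelected M X (R.tailComp X)
    · exact ⟨_, ⟨X, hX, R'.tailComp X, hR.symm.isTight, fun hs' => hR.1 (hs.eq hM hX hs'), rfl⟩,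
        (SimpleGraph.EdgeSeparation.distinguishesEfficiently_incident hR.symm).symm⟩
    · exact ⟨_, ⟨X, hX, R.tailComp X, hR.isTight, hs, rfl⟩,
        SimpleGraph.EdgeSeparation.distinguishesEfficiently_incident hR⟩
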